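/- Let $\mathcal F^2(\mathbb C)$ be the Fock space of entire functions that are square integrable with respect to the Gaussian measure $\frac1\pi e^{-|z|^2}\,dV(z)$, with the inner product of $L^2$. A conjugation on $\mathcal F^2(\mathbb C)$ is an anti-linear, involutive, isometric map $\mathcal C:\mathcal F^2(\mathbb C)\to\mathcal F^2(\mathbb C)$; a closed, densely defined linear operator $T$ is $\mathcal C$-selfadjoint if $T=\mathcal C T^*\mathcal C$ (with equality of domains, where $\operatorname{dom}(\mathcal C T^*\mathcal C)=\{f:\mathcal C f\in\operatorname{dom}(T^*)\}$). **Theorem.** Let $n\ge 1$, let $\psi_0,\psi_n$ be entire functions, let $\mathcal C$ be an arbitrary conjugation on $\mathcal F^2(\mathbb C)$, and let $V$ be a $\mathcal C$-selfadjoint operator in $\mathcal F^2(\mathbb C)$, with a domain not assumed to be maximal, such that $$Vf=\psi_0 f+\psi_n f^{(n)},\qquad f\in\operatorname{dom}(V).$$ If $\psi_n$ has a zero of order (exactly) $n$ at $w\in\mathbb C$, then the set $\sigma_p(V)$ of eigenvalues of $V$ is $$\sigma_p(V)=\Bigl\{\psi_0(w)\Bigr\}\cup\Bigl\{\psi_0(w)+\binom{k}{n}\psi_n^{(n)}(w)\;:\;k\in\mathbb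 N,\ k\ge n\Bigr\}.$$ -/

import Mathlib

open MeasureTheory Filter Topology
open scoped ENNReal ComplexConjugate LinearPMap

noncomputable section

/-! ### Closed unbounded operators, conjugations, complex selfadjointness, point spectrum -/

/-- A conjugation on a complex Hilbert space: an anti-linear operator (this is the type of `C`) that
is involutive and isometric. -/
structure IsConjugation {H : Type*} [NormedAddCommGroup H] [InnerProductSpace ℂ H]
    (C : H →ₛₗ[starRingEnd ℂ] H) : Prop where
  involutive : Function.Involutive C
  isometry : Isometry C

/-- The operator `C A C` for an unbounded operator `A` and an everywhere defined anti-linear `C`: its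
domain consists of all `f` with `C f ∈ dom A`, and `(C A C) f = C (A (C f))`. -/
def conjugatedBy {H : Type*} [NormedAddCommGroup H] [InnerProductSpace ℂ H]
    (C : H →ₛₗ[starRingEnd ℂ] H) (A : H →ₗ.[ℂ] H) : H →ₗ.[ℂ] H where
  domain := A.domain.comap C
  toFun :=
    { toFun := fun f => C (A ⟨C f, f.2⟩)
      map_add' := by
        intro f g
        rw [← map_add, ← LinearPMap.map_add]
        congr 3
        simp
      map_smul' := by
        intro r f
        have h : (⟨C ((r • f : A.domain.comap C) : H), (r • f).2⟩ : A.domain)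
            = (starRingEnd ℂ r) • ⟨C f, f.2⟩ := by
          ext
          simp
        rw [h, LinearPMap.map_smul, map_smulₛₗ]
        simp }

/-- `T` is `C`-selfadjoint: `T` is closed, densely defined and `T = C T* C` (with equal domains). -/
structure IsComplexSelfAdjoint {H : Type*} [NormedAddCommGroup H] [InnerProductSpace ℂ H]
    [CompleteSpace H] (C : H →ₛₗ[starRingEnd ℂ] H) (T : H →ₗ.[ℂ] H) : Prop where
  isClosed : T.IsClosed
  dense_domain : Dense (T.domain : Set H)
  eq_conjugated_adjoint : T = conjugatedBy C (T†)

/-- The point spectrum: the set of eigenvalues of an unbounded operator. -/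
def pointSpectrum {H : Type*} [NormedAddCommGroup H] [InnerProductSpace ℂ H]
    (T : H →ₗ.[ℂ] H) : Set ℂ :=
  {μ | ∃ f : T.domain, (f : H) ≠ 0 ∧ T f = μ • (f : H)}

/-! ### Fock space -/

/-- The Gaussian measure `π⁻¹ exp(-|z|²) dV(z)` on the complex plane. -/
def fockMeasure : Measure ℂ :=
  volume.withDensity fun z => ENNReal.ofReal (Real.pi⁻¹ * Real.exp (-‖z‖ ^ 2))

instance : IsProbabilityMeasure fockMeasure where
  measure_univ := by
    have h1 : ∫ z : ℂ, Real.exp (-1 * ‖z‖ ^ 2) = Real.pi := by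
      rw [GaussianFourier.integral_rexp_neg_mul_sq_norm one_pos]
      simp
    have hi : Integrable fun z : ℂ => Real.exp (-1 * ‖z‖ ^ 2) := by
      by_contra h
      rw [integral_undef h] at h1
      exact Real.pi_pos.ne h1
    have hi2 : Integrable fun z : ℂ => Real.pi⁻¹ * Real.exp (-‖z‖ ^ 2) := by
      simpa using hi.const_mul (Real.pi⁻¹)
    rw [fockMeasure, withDensity_apply _ MeasurableSet.univ, Measure.restrict_univ,
      ← ofReal_integral_eq_lintegral_ofReal hi2 (ae_of_all _ fun z => by positivity),
      integral_const_mul]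
    have : ∫ z : ℂ, Real.exp (-‖z‖ ^ 2) = Real.pi := by simpa using h1
    rw [this, inv_mul_cancel₀ Real.pi_pos.ne', ENNReal.ofReal_one]

theorem volume_absolutelyContinuous_fockMeasure : (volume : Measure ℂ) ≪ fockMeasure := by
  apply withDensity_absolutelyContinuous'
  · fun_prop
  · refine ae_of_all _ fun z => ?_
    have : 0 < Real.pi⁻¹ * Real.exp (-‖z‖ ^ 2) := by positivity
    simpa using this

instance : fockMeasure.IsOpenPosMeasure :=
  volume_absolutelyContinuous_fockMeasure.isOpenPosMeasure

/-- The entire functions that are square integrable with respect to the Gaussian measure. -/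
def fockSubmodule : Submodule ℂ (ℂ → ℂ) where
  carrier := {f | Differentiable ℂ f ∧ MemLp f 2 fockMeasure}
  add_mem' := fun hf hg => ⟨hf.1.add hg.1, hf.2.add hg.2⟩
  zero_mem' := ⟨differentiable_const 0, MemLp.zero⟩
  smul_mem' := fun c _ hf => ⟨hf.1.const_smul c, hf.2.const_smul c⟩

/-- Fock space. This is not reducible, so that it carries the topology of its norm and not the one
of pointwise convergence. -/
def FockSpace : Type := ↥fockSubmodule

namespace FockSpace

instance : AddCommGroup FockSpace := inferInstanceAs (AddCommGroup ↥fockSubmodule)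

instance : Module ℂ FockSpace := inferInstanceAs (Module ℂ ↥fockSubmodule)

instance : CoeFun FockSpace (fun _ => ℂ → ℂ) := ⟨fun f => f.1⟩

theorem differentiable (f : FockSpace) : Differentiable ℂ f := f.2.1

theorem memLp (f : FockSpace) : MemLp f 2 fockMeasure := f.2.2

theorem ext {f g : FockSpace} (h : ∀ z, f z = g z) : f = g := Subtype.ext (funext h)

theorem add_apply (f g : FockSpace) (z : ℂ) : (f + g) z = f z + g z := rfl

theorem sub_apply (f g : FockSpace) (z : ℂ) : (f - g) z = f z - g z := rfl

theorem smul_apply (c : ℂ) (f : FockSpace) (z : ℂ) : (c • f) z = c * f z := rfl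

theorem zero_apply (z : ℂ) : (0 : FockSpace) z = 0 := rfl

/-- The class of an element of Fock space in `L²` of the Gaussian measure. -/
def toL2 : FockSpace →ₗ[ℂ] Lp ℂ 2 fockMeasure where
  toFun f := f.memLp.toLp f
  map_add' _ _ := rfl
  map_smul' _ _ := rfl

theorem toL2_injective : Function.Injective toL2 := by
  intro f g h
  have h' : (f : ℂ → ℂ) =ᵐ[fockMeasure] g := (MemLp.toLp_eq_toLp_iff f.memLp g.memLp).1 h
  exact Subtype.ext (Continuous.ae_eq_iff_eq _ f.differentiable.continuous
    g.differentiable.continuous |>.1 h')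

theorem inner_toL2 (f g : FockSpace) :
    inner ℂ (toL2 f) (toL2 g) = ∫ z, conj (f z) * g z ∂fockMeasure := by
  rw [L2.inner_def]
  refine integral_congr_ae ?_
  filter_upwards [f.memLp.coeFn_toLp, g.memLp.coeFn_toLp] with z hf hg
  change inner ℂ ((f.memLp.toLp f : ℂ → ℂ) z) ((g.memLp.toLp g : ℂ → ℂ) z) = _
  rw [hf, hg, RCLike.inner_apply, mul_comm]

/-- The inner product of Fock space. As always in Mathlib, it is conjugate linear in the first
variable: `inner ℂ f g` is the integral of `conj f * g` against the Gaussian measure. -/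
@[reducible]
def innerCore : InnerProductSpace.Core ℂ FockSpace where
  inner f g := ∫ z, conj (f z) * g z ∂fockMeasure
  conj_inner_symm f g := by
    rw [← inner_toL2, ← inner_toL2, inner_conj_symm]
  re_inner_nonneg f := by
    rw [← inner_toL2]
    exact inner_self_nonneg
  add_left f g h := by
    rw [← inner_toL2, ← inner_toL2, ← inner_toL2, map_add, inner_add_left]
  smul_left f g r := by
    rw [← inner_toL2, ← inner_toL2, map_smul, inner_smul_left]
  definite f h := by
    rw [← inner_toL2, inner_self_eq_zero] at h
    exact toL2_injective (by rw [h, map_zero])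

instance : NormedAddCommGroup FockSpace :=
  @InnerProductSpace.Core.toNormedAddCommGroup ℂ FockSpace _ _ _ innerCore

instance : InnerProductSpace ℂ FockSpace := InnerProductSpace.ofCore innerCore.toCore

theorem inner_eq (f g : FockSpace) : inner ℂ f g = ∫ z, conj (f z) * g z ∂fockMeasure := rfl

theorem norm_toL2 (f : FockSpace) : ‖toL2 f‖ = ‖f‖ := by
  rw [@norm_eq_sqrt_re_inner ℂ, @norm_eq_sqrt_re_inner ℂ, inner_toL2, inner_eq]

theorem enorm_le_lintegral_ball {f : ℂ → ℂ} (hf : Differentiable ℂ f) (z : ℂ) :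
    ‖f z‖ₑ ≤ ∫⁻ p in Metric.ball z 1, ‖f p‖ₑ := by
  have hc := hf.continuous
  -- the mean value property on circles
  have hcirc : ∀ r : ℝ, ENNReal.ofReal (2 * Real.pi) * ‖f z‖ₑ
      ≤ ∫⁻ θ in Set.Ioo (-Real.pi) Real.pi, ‖f (z + r * (Real.cos θ + Real.sin θ * Complex.I))‖ₑ := by
    intro r
    have hmean : Real.circleAverage f z r = f z := hf.diffContOnCl.circleAverage
    have hper : Function.Periodic (fun θ => f (circleMap z r θ)) (2 * Real.pi) := fun θ => by
      simp [periodic_circleMap z r θ]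
    have h2 : ∫ θ in (-Real.pi)..Real.pi, f (circleMap z r θ) = (2 * Real.pi) • f z := by
      have h3 := hper.intervalIntegral_add_eq (-Real.pi) 0
      rw [show -Real.pi + 2 * Real.pi = Real.pi by ring, zero_add] at h3
      rw [h3, ← hmean, Real.circleAverage_def, smul_inv_smul₀ (by positivity)]
    rw [intervalIntegral.integral_of_le (by linarith [Real.pi_pos]),
      integral_Ioc_eq_integral_Ioo] at h2
    have h4 : ‖(2 * Real.pi) • f z‖ₑ ≤ _ := h2 ▸ enorm_integral_le_lintegral_enorm _
    rw [enorm_smul, Real.enorm_eq_ofReal (by positivity)] at h4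
    refine h4.trans (le_of_eq ?_)
    refine lintegral_congr fun θ => ?_
    rw [circleMap, Complex.exp_mul_I]
    simp
  have htrans : ∫⁻ p in Metric.ball z 1, ‖f p‖ₑ
      = ∫⁻ p, (Metric.ball (0 : ℂ) 1).indicator (fun p => ‖f (z + p)‖ₑ) p := by
    rw [← lintegral_indicator measurableSet_ball,
      ← lintegral_add_left_eq_self _ z]
    refine lintegral_congr fun p => ?_
    simp [Set.indicator]
  have hmeas : Measurable fun p : ℝ × ℝ => ENNReal.ofReal p.1 •
      (Metric.ball (0 : ℂ) 1).indicator (fun p => ‖f (z + p)‖ₑ) (Complex.polarCoord.symm p) := by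
    have h1 : Measurable ((Metric.ball (0 : ℂ) 1).indicator (fun p => ‖f (z + p)‖ₑ)) :=
      Measurable.indicator (hc.comp (by fun_prop)).measurable.enorm measurableSet_ball
    have h2 : Measurable fun p : ℝ × ℝ => Complex.polarCoord.symm p := by
      simp only [Complex.polarCoord_symm_apply]
      fun_prop
    simp only [smul_eq_mul]
    exact (by fun_prop : Measurable fun p : ℝ × ℝ => ENNReal.ofReal p.1).mul (h1.comp h2)
  rw [htrans, ← Complex.lintegral_comp_polarCoord_symm, polarCoord_target, Measure.volume_eq_prod,
    ← Measure.prod_restrict, lintegral_prod _ hmeas.aemeasurable]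
  calc ‖f z‖ₑ
      ≤ ∫⁻ _ in Set.Ioo (1 / 2 : ℝ) 1,
          ENNReal.ofReal (1 / 2) * (ENNReal.ofReal (2 * Real.pi) * ‖f z‖ₑ) := by
        rw [setLIntegral_const, Real.volume_Ioo, ← mul_assoc, mul_comm, ← mul_assoc,
          ← ENNReal.ofReal_mul (by norm_num), ← ENNReal.ofReal_mul (by norm_num)]
        refine le_mul_of_one_le_left zero_le ?_
        rw [ENNReal.one_le_ofReal]
        linarith [Real.pi_gt_three]
    _ ≤ ∫⁻ r in Set.Ioo (1 / 2 : ℝ) 1, ∫⁻ θ in Set.Ioo (-Real.pi) Real.pi,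
          ENNReal.ofReal r • (Metric.ball (0 : ℂ) 1).indicator (fun p => ‖f (z + p)‖ₑ)
            (Complex.polarCoord.symm (r, θ)) := by
        refine setLIntegral_mono' measurableSet_Ioo fun r hr => ?_
        have hr0 : 0 < r := by linarith [hr.1]
        have : ∀ θ : ℝ, ENNReal.ofReal r • (Metric.ball (0 : ℂ) 1).indicator
            (fun p => ‖f (z + p)‖ₑ) (Complex.polarCoord.symm (r, θ))
            = ENNReal.ofReal r * ‖f (z + r * (Real.cos θ + Real.sin θ * Complex.I))‖ₑ := by
          intro θ
          rw [Set.indicator_of_mem, smul_eq_mul, Complex.polarCoord_symm_apply]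
          rw [mem_ball_zero_iff, Complex.norm_polarCoord_symm, abs_of_pos hr0]
          exact hr.2
        simp only [this]
        rw [lintegral_const_mul' _ _ ENNReal.ofReal_ne_top]
        exact mul_le_mul' (ENNReal.ofReal_le_ofReal hr.1.le) (hcirc r)
    _ ≤ _ := lintegral_mono_set fun r hr => by
        have : (0 : ℝ) < r := by linarith [hr.1]
        exact this

theorem norm_apply_le (R : ℝ) : ∃ B : ℝ, ∀ (f : FockSpace) (z : ℂ), ‖z‖ ≤ R → ‖f z‖ ≤ B * ‖f‖ := by
  refine ⟨Real.pi * Real.exp ((R + 1) ^ 2), fun f z hz => ?_⟩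
  set B := Real.pi * Real.exp ((R + 1) ^ 2) with hB
  have hB0 : 0 ≤ B := by positivity
  have hm : Measurable fun p : ℂ => ‖f p‖ₑ := f.differentiable.continuous.measurable.enorm
  have hnorm : eLpNorm f 2 fockMeasure = ENNReal.ofReal ‖f‖ := by
    rw [← norm_toL2]
    change _ = ENNReal.ofReal ‖f.memLp.toLp f‖
    rw [Lp.norm_toLp, ENNReal.ofReal_toReal f.memLp.2.ne]
  have key : ‖f z‖ₑ ≤ ENNReal.ofReal B * ENNReal.ofReal ‖f‖ := by
    calc ‖f z‖ₑ ≤ ∫⁻ p in Metric.ball z 1, ‖f p‖ₑ := enorm_le_lintegral_ball f.differentiable z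
      _ ≤ ∫⁻ p in Metric.ball z 1, ENNReal.ofReal B *
            (ENNReal.ofReal (Real.pi⁻¹ * Real.exp (-‖p‖ ^ 2)) * ‖f p‖ₑ) := by
          refine setLIntegral_mono' measurableSet_ball fun p hp => ?_
          rw [← mul_assoc, ← ENNReal.ofReal_mul hB0]
          refine le_mul_of_one_le_left zero_le ?_
          rw [ENNReal.one_le_ofReal]
          have hp1 : ‖p‖ ≤ R + 1 := by
            have h1 : ‖p - z‖ < 1 := by simpa [dist_eq_norm] using hp
            have h2 := norm_add_le (p - z) z
            rw [sub_add_cancel] at h2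
            linarith
          have : B * (Real.pi⁻¹ * Real.exp (-‖p‖ ^ 2)) = Real.exp ((R + 1) ^ 2 - ‖p‖ ^ 2) := by
            rw [hB, sub_eq_add_neg, Real.exp_add]
            field_simp
          rw [this, Real.one_le_exp_iff]
          nlinarith [norm_nonneg p]
      _ ≤ ∫⁻ p, ENNReal.ofReal B *
            (ENNReal.ofReal (Real.pi⁻¹ * Real.exp (-‖p‖ ^ 2)) * ‖f p‖ₑ) :=
          setLIntegral_le_lintegral _ _
      _ = ENNReal.ofReal B * ∫⁻ p, ‖f p‖ₑ ∂fockMeasure := by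
          rw [lintegral_const_mul _ (by fun_prop), fockMeasure,
            lintegral_withDensity_eq_lintegral_mul _ (by fun_prop) hm]
          rfl
      _ ≤ ENNReal.ofReal B * ENNReal.ofReal ‖f‖ := by
          gcongr
          rw [← eLpNorm_one_eq_lintegral_enorm, ← hnorm]
          exact eLpNorm_le_eLpNorm_of_exponent_le (by norm_num) f.memLp.1
  rw [← ENNReal.ofReal_mul hB0, ← ofReal_norm] at key
  exact (ENNReal.ofReal_le_ofReal_iff (by positivity)).1 key

/-- Fock space is a Hilbert space. -/
instance : CompleteSpace FockSpace := by
  refine Metric.complete_of_cauchySeq_tendsto fun u hu => ?_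
  let ι : FockSpace →ₗᵢ[ℂ] Lp ℂ 2 fockMeasure := ⟨toL2, norm_toL2⟩
  -- pointwise limit
  have hpt : ∀ z, ∃ a, Tendsto (fun m => u m z) atTop (𝓝 a) := by
    intro z
    obtain ⟨B, hB⟩ := norm_apply_le ‖z‖
    apply cauchySeq_tendsto_of_complete
    rw [Metric.cauchySeq_iff] at hu ⊢
    intro ε hε
    have hB1 : 0 < |B| + 1 := by positivity
    obtain ⟨N, hN⟩ := hu (ε / (|B| + 1)) (by positivity)
    refine ⟨N, fun m hm k hk => ?_⟩
    have h1 := hN m hm k hk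
    rw [dist_eq_norm] at h1 ⊢
    have h2 := hB (u m - u k) z le_rfl
    rw [sub_apply] at h2
    rw [lt_div_iff₀ hB1] at h1
    nlinarith [le_abs_self B, norm_nonneg (u m - u k)]
  choose F hF using hpt
  have hloc : TendstoLocallyUniformlyOn (fun m => (u m : ℂ → ℂ)) F atTop Set.univ := by
    rw [tendstoLocallyUniformlyOn_univ, tendstoLocallyUniformly_iff_forall_isCompact]
    intro K hK
    obtain ⟨R, hR⟩ := hK.isBounded.exists_norm_le
    obtain ⟨B, hB⟩ := norm_apply_le R
    refine UniformCauchySeqOn.tendstoUniformlyOn_of_tendsto ?_ fun z _ => hF z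
    rw [Metric.uniformCauchySeqOn_iff]
    rw [Metric.cauchySeq_iff] at hu
    intro ε hε
    have hB1 : 0 < |B| + 1 := by positivity
    obtain ⟨N, hN⟩ := hu (ε / (|B| + 1)) (by positivity)
    refine ⟨N, fun m hm k hk z hz => ?_⟩
    have h1 := hN m hm k hk
    rw [dist_eq_norm] at h1 ⊢
    have h2 := hB (u m - u k) z (hR z hz)
    rw [sub_apply] at h2
    rw [lt_div_iff₀ hB1] at h1
    nlinarith [le_abs_self B, norm_nonneg (u m - u k)]
  have hFd : Differentiable ℂ F := by
    rw [← differentiableOn_univ]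
    exact hloc.differentiableOn (.of_forall fun m => (u m).differentiable.differentiableOn)
      isOpen_univ
  obtain ⟨G, hG⟩ := cauchySeq_tendsto_of_complete (ι.isometry.uniformContinuous.comp_cauchySeq hu)
  have hGF : (G : ℂ → ℂ) =ᵐ[fockMeasure] F := by
    obtain ⟨ns, hns, hlim⟩ := (tendstoInMeasure_of_tendsto_Lp hG).exists_seq_tendsto_ae
    have hall : ∀ᵐ z ∂fockMeasure, ∀ m, (ι (u m) : ℂ → ℂ) z = u m z :=
      ae_all_iff.2 fun m => (u m).memLp.coeFn_toLp
    filter_upwards [hlim, hall] with z hz hz'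
    refine tendsto_nhds_unique hz ?_
    have h := (hF z).comp hns.tendsto_atTop
    refine h.congr fun m => ?_
    exact (hz' (ns m)).symm
  let g : FockSpace := ⟨F, hFd, (memLp_congr_ae hGF).1 (Lp.memLp G)⟩
  have hg : ι g = G := by
    refine Lp.ext ?_
    exact (g.memLp.coeFn_toLp).trans hGF.symm
  refine ⟨g, ?_⟩
  rw [ι.isometry.isEmbedding.tendsto_nhds_iff, hg]
  exact hG

end FockSpace

end

/- On a `C`-selfadjoint operator `T`, a nonzero bounded functional `L` with `L ∘ T = μ L` is an
eigenvector of `T†` for `conj μ`, which `C` turns into an eigenvector of `T` for `μ`. So it suffices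
to find such functionals. Let `e k f = f⁽ᵏ⁾(w)`. Since the coefficient of `f⁽ʳ⁾` vanishes to order
`r` at `w`, Leibniz' rule expresses `e k ∘ T` through `e 0, …, e k` only. The `e k` are linearly
independent, so every diagonal entry of this triangular array has an eigenfunctional; they separate
points, so the first `k` with `e k f ≠ 0` shows that every eigenvalue is a diagonal entry. -/

section Conjugation

variable {H : Type*} [NormedAddCommGroup H] [InnerProductSpace ℂ H]

theorem pointSpectrum_mono {S T : H →ₗ.[ℂ] H} (h : S ≤ T) : pointSpectrum S ⊆ pointSpectrum T := by
  rintro μ ⟨f, hf₀, hf⟩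
  refine ⟨⟨f, h.1 f.2⟩, hf₀, ?_⟩
  rw [← h.2 (x := f) rfl, hf]

theorem mem_pointSpectrum_conjugatedBy {C : H →ₛₗ[starRingEnd ℂ] H} (hC : Function.Involutive C)
    {A : H →ₗ.[ℂ] H} {μ : ℂ} (hμ : conj μ ∈ pointSpectrum A) :
    μ ∈ pointSpectrum (conjugatedBy C A) := by
  obtain ⟨g, hg₀, hg⟩ := hμ
  have hmem : C (C g) ∈ A.domain := (hC g).symm ▸ g.2
  have hCCg : (⟨C (C g), hmem⟩ : A.domain) = g := Subtype.ext (hC g)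
  refine ⟨⟨C g, hmem⟩, fun h => hg₀ ?_, ?_⟩
  · rw [← hC g, show C g = 0 from h, map_zero]
  · calc C (A ⟨C (C g), hmem⟩) = C (conj μ • (g : H)) := by rw [hCCg, hg]
      _ = μ • C g := by rw [map_smulₛₗ, Complex.conj_conj]

theorem conj_mem_pointSpectrum_adjoint [CompleteSpace H] {T : H →ₗ.[ℂ] H}
    (hT : Dense (T.domain : Set H)) {L : StrongDual ℂ H} (hL : L ≠ 0) {μ : ℂ}
    (h : ∀ f : T.domain, L (T f) = μ * L f) : conj μ ∈ pointSpectrum T† := by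
  set g : H := (InnerProductSpace.toDual ℂ H).symm L with hg
  have hgL (x : H) : inner ℂ g x = L x := InnerProductSpace.toDual_symm_apply
  have hadj (f : T.domain) : inner ℂ (conj μ • g) (f : H) = inner ℂ g (T f) := by
    rw [inner_smul_left, hgL, hgL, h, Complex.conj_conj]
  have hmem : g ∈ T†.domain := LinearPMap.mem_adjoint_domain_of_exists g ⟨_, hadj⟩
  have hg₀ : g ≠ 0 := by rwa [hg, Ne, LinearIsometryEquiv.map_eq_zero_iff]
  exact ⟨⟨g, hmem⟩, hg₀, LinearPMap.adjoint_apply_eq hT ⟨g, hmem⟩ hadj⟩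

end Conjugation

/-- `T` is lower triangular, with diagonal `d`, with respect to the family `e` of functionals: on
the domain of `T`, the functional `e k ∘ T` is `d k • e k` plus a combination of the `e j` with
`j < k`. -/
def IsTriangular {𝕜 H ι : Type*} [NontriviallyNormedField 𝕜] [NormedAddCommGroup H]
    [NormedSpace 𝕜 H] [Preorder ι] (T : H →ₗ.[𝕜] H) (e : ι → StrongDual 𝕜 H) (d : ι → 𝕜) : Prop :=
  ∀ k, ∃ M ∈ Submodule.span 𝕜 (e '' Set.Iio k), ∀ f : T.domain, e k (T f) = d k * e k f + M f

namespace IsTriangular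

section NormedSpace

variable {𝕜 H ι : Type*} [NontriviallyNormedField 𝕜] [NormedAddCommGroup H] [NormedSpace 𝕜 H]
  [Preorder ι] [WellFoundedLT ι] {T : H →ₗ.[𝕜] H} {e : ι → StrongDual 𝕜 H} {d : ι → 𝕜}

theorem exists_mem_span_apply_sub_mul (hT : IsTriangular T e d) {k : ι} {μ : 𝕜}
    (hμ : ∀ j < k, d j ≠ μ) {M : StrongDual 𝕜 H} (hM : M ∈ Submodule.span 𝕜 (e '' Set.Iio k)) :
    ∃ N ∈ Submodule.span 𝕜 (e '' Set.Iio k), ∀ f : T.domain, N (T f) - μ * N f = M f := by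
  induction k using WellFoundedLT.induction generalizing M with | ind k ih =>
  induction hM using Submodule.span_induction with
  | mem M hM =>
    obtain ⟨j, hj : j < k, rfl⟩ := hM
    obtain ⟨M', hM', hTj⟩ := hT j
    obtain ⟨N, hN, hTN⟩ := ih j hj (fun i hi => hμ i (hi.trans hj)) hM'
    have hle : Submodule.span 𝕜 (e '' Set.Iio j) ≤ Submodule.span 𝕜 (e '' Set.Iio k) :=
      Submodule.span_mono (Set.image_mono (Set.Iio_subset_Iio hj.le))
    refine ⟨(d j - μ)⁻¹ • (e j - N), Submodule.smul_mem _ _ <| Submodule.sub_mem _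
      (Submodule.subset_span ⟨j, hj, rfl⟩) (hle hN), fun f => ?_⟩
    have hdj : d j - μ ≠ 0 := sub_ne_zero.2 (hμ j hj)
    simp only [smul_apply, sub_apply, smul_eq_mul]
    rw [hTj f]
    field_simp
    linear_combination - hTN f
  | zero => exact ⟨0, Submodule.zero_mem _, fun f => by simp⟩
  | add M₁ M₂ _ _ h₁ h₂ =>
    obtain ⟨N₁, hN₁, hT₁⟩ := h₁
    obtain ⟨N₂, hN₂, hT₂⟩ := h₂
    refine ⟨N₁ + N₂, Submodule.add_mem _ hN₁ hN₂, fun f => ?_⟩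
    simp only [add_apply]
    linear_combination hT₁ f + hT₂ f
  | smul c M _ h =>
    obtain ⟨N, hN, hTN⟩ := h
    refine ⟨c • N, Submodule.smul_mem _ c hN, fun f => ?_⟩
    simp only [smul_apply, smul_eq_mul]
    linear_combination c * hTN f

theorem exists_eigenfunctional (hT : IsTriangular T e d) (he : LinearIndependent 𝕜 e) (k : ι) :
    ∃ L : StrongDual 𝕜 H, L ≠ 0 ∧ ∀ f : T.domain, L (T f) = d k * L f := by
  -- Below the first index with diagonal entry `d k`, the operator `L ↦ L ∘ T - d k • L` is onto.
  obtain ⟨l, hl : d l = d k, hmin⟩ :=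
    (wellFounded_lt (α := ι)).has_min {l | d l = d k} ⟨k, rfl⟩
  obtain ⟨M, hM, hTl⟩ := hT l
  obtain ⟨N, hN, hTN⟩ :=
    hT.exists_mem_span_apply_sub_mul (fun j hj hjk => hmin j hjk hj) hM
  refine ⟨e l - N, fun h => ?_, fun f => ?_⟩
  · exact he.notMem_span_image Set.self_notMem_Iio (sub_eq_zero.1 h ▸ hN)
  · simp only [sub_apply]
    linear_combination hTl f - hTN f + e l f * hl

end NormedSpace

variable {H ι : Type*} [NormedAddCommGroup H] [InnerProductSpace ℂ H] [Preorder ι]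
  [WellFoundedLT ι] {T : H →ₗ.[ℂ] H} {e : ι → StrongDual ℂ H} {d : ι → ℂ}

theorem pointSpectrum_subset_range (hT : IsTriangular T e d)
    (he : ∀ f : H, (∀ k, e k f = 0) → f = 0) : pointSpectrum T ⊆ Set.range d := by
  rintro μ ⟨f, hf₀, hf⟩
  have hex : ∃ k, e k f ≠ 0 := not_forall.1 (mt (he f) hf₀)
  obtain ⟨k, hk, hmin⟩ := (wellFounded_lt (α := ι)).has_min {k | e k (f : H) ≠ 0} hex
  obtain ⟨M, hM, hTk⟩ := hT k
  have hspan : Submodule.span ℂ (e '' Set.Iio k) ≤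
      (ContinuousLinearMap.apply ℂ ℂ (f : H)).ker := by
    rw [Submodule.span_le]
    rintro _ ⟨j, hj, rfl⟩
    exact not_not.1 fun h => hmin j h hj
  have hMf : M f = 0 := hspan hM
  refine ⟨k, mul_right_cancel₀ hk ?_⟩
  calc d k * e k f = e k (T f) := by rw [hTk, hMf, add_zero]
    _ = μ * e k f := by rw [hf, map_smul, smul_eq_mul]

theorem range_subset_pointSpectrum [CompleteSpace H] (hT : IsTriangular T e d)
    (he : LinearIndependent ℂ e) (hdense : Dense (T.domain : Set H))
    {C : H →ₛₗ[starRingEnd ℂ] H} (hC : Function.Involutive C) (hCT : conjugatedBy C T† ≤ T) :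
    Set.range d ⊆ pointSpectrum T := by
  rintro _ ⟨k, rfl⟩
  obtain ⟨L, hL, hLT⟩ := hT.exists_eigenfunctional he k
  exact pointSpectrum_mono hCT <|
    mem_pointSpectrum_conjugatedBy hC (conj_mem_pointSpectrum_adjoint hdense hL hLT)

end IsTriangular

theorem analyticAt_iteratedDeriv {𝕜 E : Type*} [NontriviallyNormedField 𝕜] [NormedAddCommGroup E]
    [NormedSpace 𝕜 E] [CompleteSpace E] {f : 𝕜 → E} {w : 𝕜} (hf : AnalyticAt 𝕜 f w) (k : ℕ) :
    AnalyticAt 𝕜 (iteratedDeriv k f) w := by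
  rw [iteratedDeriv_eq_iterate]
  exact hf.iterated_deriv k

theorem iteratedDeriv_mul_iteratedDeriv_of_le_analyticOrderAt {𝕜 : Type*}
    [NontriviallyNormedField 𝕜] [CharZero 𝕜] [CompleteSpace 𝕜] {ψ f : 𝕜 → 𝕜} {w : 𝕜} {r : ℕ}
    (hψ : AnalyticAt 𝕜 ψ w) (hr : r ≤ analyticOrderAt ψ w) (hf : AnalyticAt 𝕜 f w) (k : ℕ) :
    iteratedDeriv k (ψ * iteratedDeriv r f) w = ∑ l ∈ Finset.range (k + 1),
      k.choose (r + l) * iteratedDeriv (r + l) ψ w * iteratedDeriv (k - l) f w := by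
  have hψr : ∀ i < r, iteratedDeriv i ψ w = 0 :=
    (natCast_le_analyticOrderAt_iff_iteratedDeriv_eq_zero hψ).1 hr
  have hcomp (m : ℕ) : iteratedDeriv m (iteratedDeriv r f) = iteratedDeriv (m + r) f := by
    simp only [iteratedDeriv_eq_iterate, Function.iterate_add_apply]
  calc iteratedDeriv k (ψ * iteratedDeriv r f) w
      = ∑ i ∈ Finset.range (k + 1),
          k.choose i * iteratedDeriv i ψ w * iteratedDeriv (k - i + r) f w := by
        rw [iteratedDeriv_mul hψ.contDiffAt (analyticAt_iteratedDeriv hf r).contDiffAt]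
        simp only [hcomp]
    _ = ∑ i ∈ Finset.range (r + (k + 1)),
          k.choose i * iteratedDeriv i ψ w * iteratedDeriv (k - i + r) f w := by
        refine Finset.sum_subset (Finset.range_mono (by omega)) fun i _ hi => ?_
        rw [Nat.choose_eq_zero_of_lt (by simpa using hi), Nat.cast_zero, zero_mul, zero_mul]
    _ = ∑ l ∈ Finset.range (k + 1), k.choose (r + l) * iteratedDeriv (r + l) ψ w *
          iteratedDeriv (k - (r + l) + r) f w := by
        rw [Finset.sum_range_add, Finset.sum_eq_zero, zero_add]
        intro i hi
        rw [hψr i (Finset.mem_range.1 hi), mul_zero, zero_mul]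
    _ = _ := by
        refine Finset.sum_congr rfl fun l _ => ?_
        rcases le_or_gt (r + l) k with h | h
        · rw [show k - (r + l) + r = k - l by omega]
        · simp [Nat.choose_eq_zero_of_lt h]

namespace FockSpace

/-- The functional `f ↦ f⁽ʲ⁾(w)`, which is bounded on Fock space by Cauchy's estimate. -/
noncomputable def iteratedDerivCLM (j : ℕ) (w : ℂ) : StrongDual ℂ FockSpace :=
  LinearMap.mkContinuousOfExistsBound
    { toFun := fun f => iteratedDeriv j f w
      map_add' := fun f g => iteratedDeriv_add f.differentiable.contDiff.contDiffAt
        g.differentiable.contDiff.contDiffAt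
      map_smul' := fun c f => iteratedDeriv_const_smul_field c (f : ℂ → ℂ) } <| by
    obtain ⟨B, hB⟩ := norm_apply_le (‖w‖ + 1)
    refine ⟨j.factorial * B, fun f => ?_⟩
    have hsphere : ∀ z ∈ Metric.sphere w 1, ‖f z‖ ≤ B * ‖f‖ := fun z hz =>
      hB f z (norm_le_of_mem_closedBall (Metric.sphere_subset_closedBall hz))
    have hcauchy := Complex.norm_iteratedDeriv_le_of_forall_mem_sphere_norm_le j one_pos
      f.differentiable.diffContOnCl hsphere
    exact hcauchy.trans_eq (by rw [one_pow, div_one, mul_assoc])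

theorem iteratedDerivCLM_apply (j : ℕ) (w : ℂ) (f : FockSpace) :
    iteratedDerivCLM j w f = iteratedDeriv j f w := rfl

theorem eq_zero_of_forall_iteratedDeriv_eq_zero {f : FockSpace} {w : ℂ}
    (h : ∀ k, iteratedDeriv k f w = 0) : f = 0 :=
  ext fun z => by
    simpa [h, zero_apply] using
      (Complex.taylorSeries_eq_of_entire' (c := w) (z := z) f.differentiable).symm

theorem memLp_pow (k : ℕ) : MemLp (fun z : ℂ => z ^ k) 2 fockMeasure := by
  have hint : Integrable fun z : ℂ => ‖z‖ ^ (2 * k : ℝ) * Real.exp (-‖z‖ ^ (2 : ℝ)) := by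
    refine .of_integral_ne_zero ?_
    rw [Complex.integral_rpow_mul_exp_neg_rpow one_le_two (by linarith [k.cast_nonneg (α := ℝ)])]
    have := Real.Gamma_pos_of_pos (by positivity : 0 < (2 * k + 2 : ℝ) / 2)
    positivity
  rw [memLp_two_iff_integrable_sq_norm (by fun_prop), fockMeasure,
    integrable_withDensity_iff (by fun_prop) (ae_of_all _ fun _ => ENNReal.ofReal_lt_top)]
  refine (hint.const_mul Real.pi⁻¹).congr (ae_of_all _ fun z => ?_)
  have hpow : ‖z‖ ^ (2 * k : ℝ) = ‖z ^ k‖ ^ 2 := by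
    rw [norm_pow, ← pow_mul, mul_comm k, ← Real.rpow_natCast]
    push_cast
    rfl
  dsimp only
  rw [hpow, Real.rpow_two, ENNReal.toReal_ofReal (by positivity)]
  ring

/-- A polynomial as an element of Fock space. -/
noncomputable def ofPolynomial (p : Polynomial ℂ) : FockSpace :=
  ⟨fun z => p.eval z, p.differentiable, by
    simp only [Polynomial.eval_eq_sum_range]
    exact memLp_finsetSum _ fun k _ => (memLp_pow k).const_mul _⟩

theorem iteratedDeriv_ofPolynomial_X_sub_C_pow (w : ℂ) (j k : ℕ) :
    iteratedDeriv j (ofPolynomial ((.X - .C w) ^ k)) w =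
      if j = k then (k.factorial : ℂ) else 0 := by
  have hcoe : (ofPolynomial ((.X - .C w) ^ k) : ℂ → ℂ) = fun z => (z - w) ^ k :=
    funext fun z => by simp [ofPolynomial]
  rw [hcoe, iteratedDeriv_comp_sub_const j (fun z : ℂ => z ^ k) w]
  simp only [sub_self]
  rw [iteratedDeriv_fun_pow_zero]
  split_ifs <;> simp_all

theorem linearIndependent_iteratedDerivCLM (w : ℂ) :
    LinearIndependent ℂ fun j => iteratedDerivCLM j w := by
  rw [linearIndependent_iff']
  intro s c hc k hk
  simpa [iteratedDerivCLM_apply, iteratedDeriv_ofPolynomial_X_sub_C_pow, hk, Nat.factorial_ne_zero]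
    using DFunLike.congr_fun hc (ofPolynomial ((.X - .C w) ^ k))

theorem isTriangular_iteratedDerivCLM {ι : Type*} [Fintype ι] {r : ι → ℕ} {ψ : ι → ℂ → ℂ} {w : ℂ}
    (hψ : ∀ i, AnalyticAt ℂ (ψ i) w) (hr : ∀ i, r i ≤ analyticOrderAt (ψ i) w)
    {T : FockSpace →ₗ.[ℂ] FockSpace}
    (hT : ∀ f : T.domain, T f =ᶠ[𝓝 w] ∑ i, ψ i * iteratedDeriv (r i) (f : FockSpace)) :
    IsTriangular T (fun k => iteratedDerivCLM k w)
      fun k => ∑ i, k.choose (r i) * iteratedDeriv (r i) (ψ i) w := by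
  intro k
  refine ⟨∑ i, ∑ l ∈ Finset.range k, (k.choose (r i + (l + 1)) *
    iteratedDeriv (r i + (l + 1)) (ψ i) w) • iteratedDerivCLM (k - (l + 1)) w, ?_, fun f => ?_⟩
  · refine Submodule.sum_mem _ fun i _ => Submodule.sum_mem _ fun l hl =>
      Submodule.smul_mem _ _ (Submodule.subset_span ⟨k - (l + 1), ?_, rfl⟩)
    have := Finset.mem_range.1 hl
    simp only [Set.mem_Iio]
    omega
  · have hf : AnalyticAt ℂ (f : FockSpace) w := (f : FockSpace).differentiable.analyticAt w
    have hexpand : iteratedDeriv k (T f) w = ∑ i, ∑ l ∈ Finset.range (k + 1),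
        k.choose (r i + l) * iteratedDeriv (r i + l) (ψ i) w *
          iteratedDeriv (k - l) (f : FockSpace) w := by
      rw [(hT f).iteratedDeriv_eq, iteratedDeriv_sum fun i _ =>
        ((hψ i).mul (analyticAt_iteratedDeriv hf (r i))).contDiffAt]
      exact Finset.sum_congr rfl fun i _ =>
        iteratedDeriv_mul_iteratedDeriv_of_le_analyticOrderAt (hψ i) (hr i) hf k
    simp only [iteratedDerivCLM_apply, hexpand, Finset.sum_range_succ', Finset.sum_add_distrib,
      _root_.sum_apply, _root_.smul_apply, smul_eq_mul, Finset.sum_mul,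
      add_zero, Nat.sub_zero]
    ring

end FockSpace

theorem range_add_choose_mul {R : Type*} [Semiring R] {n : ℕ} (hn : n ≠ 0) (a b : R) :
    (Set.range fun k : ℕ => a + k.choose n * b) =
      {x | x = a ∨ ∃ k, n ≤ k ∧ x = a + k.choose n * b} := by
  ext x
  constructor
  · rintro ⟨k, rfl⟩
    rcases le_or_gt n k with h | h
    · exact .inr ⟨k, h, rfl⟩
    · exact .inl (by simp [Nat.choose_eq_zero_of_lt h])
  · rintro (rfl | ⟨k, -, rfl⟩)
    · exact ⟨0, by simp [Nat.choose_eq_zero_of_lt (Nat.pos_of_ne_zero hn)]⟩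
    · exact ⟨k, rfl⟩

theorem theorem6p4_general {ι : Type*} [Fintype ι] {r : ι → ℕ} {ψ : ι → ℂ → ℂ} {w : ℂ}
    (hψ : ∀ i, AnalyticAt ℂ (ψ i) w) (hr : ∀ i, r i ≤ analyticOrderAt (ψ i) w)
    {C : FockSpace →ₛₗ[starRingEnd ℂ] FockSpace} (hC : Function.Involutive C)
    {V : FockSpace →ₗ.[ℂ] FockSpace} (hdense : Dense (V.domain : Set FockSpace))
    (hCV : conjugatedBy C V† ≤ V)
    (hV : ∀ f : V.domain, V f =ᶠ[𝓝 w] ∑ i, ψ i * iteratedDeriv (r i) (f : FockSpace)) :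
    pointSpectrum V =
      Set.range fun k : ℕ => ∑ i, k.choose (r i) * iteratedDeriv (r i) (ψ i) w := by
  have hT := FockSpace.isTriangular_iteratedDerivCLM hψ hr hV
  exact Set.Subset.antisymm
    (hT.pointSpectrum_subset_range fun _ => FockSpace.eq_zero_of_forall_iteratedDeriv_eq_zero)
    (hT.range_subset_pointSpectrum (FockSpace.linearIndependent_iteratedDerivCLM w) hdense hC hCV)

theorem theorem6p4 (n : ℕ) (hn : 1 ≤ n) (ψ₀ ψₙ : ℂ → ℂ)
    (hψ₀ : Differentiable ℂ ψ₀) (hψₙ : Differentiable ℂ ψₙ)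
    (C : FockSpace →ₛₗ[starRingEnd ℂ] FockSpace) (hC : IsConjugation C)
    (V : FockSpace →ₗ.[ℂ] FockSpace)
    (hV : ∀ (f : V.domain) (z : ℂ),
      (V f) z = ψ₀ z * (f : FockSpace) z + ψₙ z * iteratedDeriv n (f : FockSpace) z)
    (hCV : IsComplexSelfAdjoint C V)
    (w : ℂ) (hw : analyticOrderAt ψₙ w = n) :
    pointSpectrum V =
      {μ : ℂ | μ = ψ₀ w ∨ ∃ k : ℕ, n ≤ k ∧ μ = ψ₀ w + (k.choose n : ℂ) * iteratedDeriv n ψₙ w} := by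
  have h := theorem6p4_general (r := ![0, n]) (ψ := ![ψ₀, ψₙ]) (w := w)
    (by simp [Fin.forall_fin_two, hψ₀.analyticAt, hψₙ.analyticAt])
    (by simp [Fin.forall_fin_two, hw]) hC.involutive hCV.dense_domain hCV.eq_conjugated_adjoint.ge
    fun f => .of_forall fun z => by simp [hV]
  simpa [Fin.sum_univ_two, range_add_choose_mul (Nat.one_le_iff_ne_zero.1 hn)] using h
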